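/- Let $X$ and $Y$ be finite-dimensional real Hilbert spaces (for instance $X=\mathbb{R}^n$, $Y=\mathbb{R}^m$ with the Euclidean inner products). Let $f:X\to\mathbb{R}$ be convex and continuously differentiable, let $g:Y\to\mathbb{R}\cup\{+\infty\}$ be proper, lower semicontinuous and convex, and let $c:X\to Y$ be continuously differentiable and such that, for all $x,x'\in X$ and $\lambda\in[0,1]$, $$c(\lambda x+(1-\lambda)x')-\lambda c(x)-(1-\lambda)c(x')\in \operatorname{hzn} g:=\{v\in Y\mid \forall z\in\operatorname{dom} g:\ g(z+v)\le g(z)\}.$$ Consider the problem (P) of minimizing $\Phi(x):=f(x)+g(c(x))$ over $x\in X$. Assume that (P) is feasible and possesses a minimizer, and let $\Phi^*$ be its minimal value. A feasible point $\bar x$ is called stationary if there is $\bar y\in Y$ with $\nabla f(\bar x)+c'(\bar x)^\top\bar y=0$ and $c(\bar x)\in\partial g^*(\bar y)$ (equivalently, $\bar y\in\partial g(c(\bar x))$), where $g^*$ is the conjugate of $g$. Assume that no minimizer of (P) is stationary, and that the value function $\mathcal{V}:Y\to\mathbb{R}\cup\{\pm\infty\}$, $\mathcal{V}(u):=\inf_{x}\{f(x)+g(c(x)-u)\}$,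 is proper and lower semicontinuous. For $\mu>0$, let $\mathcal{L}_\mu(x,y):=f(x)+\inf_z\{g(z)+\langle y,c(x)-z\rangle+\tfrac1{2\mu}\|c(x)-z\|^2\}$ be the augmented Lagrangian. Let $\{(x^k,z^k,y^k)\}_{k\ge0}$ be generated by the classical augmented Lagrangian method: given $\mu_0>0$, $y^0\in Y$ and $\beta\in(0,1)$, for $k=0,1,2,\dots$, 1. select $\varepsilon_k\ge0$ and $x^k\in X$ with $\mathcal{L}_{\mu_k}(x^k,y^k)\le\inf_x\mathcal{L}_{\mu_k}(x,y^k)+\varepsilon_k$; 2. set $z^k:=\operatorname{prox}_{\mu_k g}(c(x^k)+\mu_k y^k)$, the unique minimizer of $w\mapsto g(w)+\tfrac{1}{2\mu_k}\|w-c(x^k)-\mu_ky^k\|^2$; 3. set $y^{k+1}:=y^k+\mu_k^{-1}(c(x^k)-z^k)$; 4. set $\mu_{k+1}:=\beta_k\mu_k$ for some $\beta_k\in(0,\beta]\cup\{1\}$. Assume that $\sum_{k=0}^\infty\sqrt{\varepsilon_k/\mu_k}<\infty$. Then $c(x^k)-z^k\to0$, $\|y^k\|\to\infty$, and $$\liminf_{k\to\infty}\bigl(f(x^k)+g(z^k)\bigr)\le\Phi^*.$$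 If, in addition, $\{x^k\}$ is bounded, then there are a point $\bar x\in X$ and a subsequence $\{x^k\}_{k\in K}$ such that $x^k\to_K\bar x$, $\bar x$ is a minimizer of (P), $z^k\to_K c(\bar x)$, and $f(x^k)+g(z^k)\to_K\Phi^*$. -/

import Mathlib

open Filter Topology Set

namespace CompositeALM

section ConvexAnalysis

variable {Y : Type*} [NormedAddCommGroup Y] [InnerProductSpace ℝ Y]

/-- An extended-real-valued function is proper: its domain `{z | φ z < ∞}` is nonempty and `φ` is
finite there (that is, `φ` never takes the value `-∞`). -/
def IsProper (φ : Y → EReal) : Prop :=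
  (∃ z, φ z < ⊤) ∧ ∀ z, φ z ≠ ⊥

/-- An extended-real-valued function is convex: its epigraph is a convex set. -/
def IsConvex (φ : Y → EReal) : Prop :=
  Convex ℝ {p : Y × ℝ | φ p.1 ≤ (p.2 : EReal)}

/-- The horizon `hzn φ = {v | ∀ z ∈ dom φ, φ (z + v) ≤ φ z}`. -/
def horizon (φ : Y → EReal) : Set Y :=
  {v | ∀ z, φ z < ⊤ → φ (z + v) ≤ φ z}

/-- The conjugate `φ* (y) = sup_z (⟨z, y⟩ - φ z)`. -/
noncomputable def conjugate (φ : Y → EReal) (y : Y) : EReal :=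
  ⨆ z, ((inner ℝ z y : ℝ) : EReal) - φ z

/-- The subdifferential of `φ` at a point `z₀` where `φ` is finite (empty at all other points). -/
def subdifferential (φ : Y → EReal) (z₀ : Y) : Set Y :=
  {y | φ z₀ ≠ ⊥ ∧ φ z₀ ≠ ⊤ ∧ ∀ z, φ z₀ + ((inner ℝ y (z - z₀) : ℝ) : EReal) ≤ φ z}

/-- `w = prox_{γ φ} (v)`: the point `w` minimizes `w' ↦ φ w' + ‖w' - v‖² / (2 γ)`. For `φ` proper,
lower semicontinuous and convex and `γ > 0`, exactly one such point exists. -/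
def IsProx (γ : ℝ) (φ : Y → EReal) (v w : Y) : Prop :=
  IsMinOn (fun w' : Y => φ w' + ((1 / (2 * γ) * ‖w' - v‖ ^ 2 : ℝ) : EReal)) univ w

end ConvexAnalysis

section Problem

variable {X Y : Type*} [NormedAddCommGroup X] [InnerProductSpace ℝ X]
  [NormedAddCommGroup Y] [InnerProductSpace ℝ Y]

/-- The objective `Φ x = f x + g (c x)` of the composite problem. -/
noncomputable def objective (f : X → ℝ) (g : Y → EReal) (c : X → Y) (x : X) : EReal :=
  (f x : EReal) + g (c x)

/-- The infimal value `Φ* = inf Φ` of the composite problem. -/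
noncomputable def optimalValue (f : X → ℝ) (g : Y → EReal) (c : X → Y) : EReal :=
  ⨅ x, objective f g c x

/-- `x` is a minimizer: it is feasible, and it minimizes `Φ` globally. -/
def IsMinimizer (f : X → ℝ) (g : Y → EReal) (c : X → Y) (x : X) : Prop :=
  g (c x) < ⊤ ∧ IsMinOn (objective f g c) univ x

/-- The standing assumptions of fully convex composite optimization. -/
structure FullyConvex (f : X → ℝ) (g : Y → EReal) (c : X → Y) : Prop where
  f_contDiff : ContDiff ℝ 1 f
  f_convex : ConvexOn ℝ univ f
  g_proper : IsProper g
  g_lsc : LowerSemicontinuous g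
  g_convex : IsConvex g
  c_contDiff : ContDiff ℝ 1 c
  /-- `c` is convex with respect to the cone `-hzn g` -/
  c_convex : ∀ x x' : X, ∀ t : ℝ, 0 ≤ t → t ≤ 1 →
    c (t • x + (1 - t) • x') - t • c x - (1 - t) • c x' ∈ horizon g
  feasible : ∃ x, g (c x) < ⊤
  exists_minimizer : ∃ x, IsMinimizer f g c x

/-- `x` is stationary: it is feasible and, for some multiplier `y`, the `x`-derivative of the
Lagrangian `L (x, y) = f x + ⟨y, c x⟩ - g* (y)` vanishes and `c x ∈ ∂g* (y)`. The second condition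
forces `g* (y)` to be finite, so the derivative of `L (·, y)` is that of `f + ⟨y, c⟩`. -/
def IsStationaryPoint (f : X → ℝ) (g : Y → EReal) (c : X → Y) (x : X) : Prop :=
  g (c x) < ⊤ ∧ ∃ y : Y,
    HasFDerivAt (fun x' : X => f x' + inner ℝ y (c x')) (0 : X →L[ℝ] ℝ) x ∧
    c x ∈ subdifferential (conjugate g) y

/-- The value function `V (u) = inf_x (f x + g (c x - u))`. -/
noncomputable def valueFunction (f : X → ℝ) (g : Y → EReal) (c : X → Y) (u : Y) : EReal :=
  ⨅ x, (f x : EReal) + g (c x - u)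

/-- The augmented Lagrangian
`L_μ (x, y) = f x + inf_z (g z + ⟨y, c x - z⟩ + ‖c x - z‖² / (2 μ))`. -/
noncomputable def augLagrangian (f : X → ℝ) (g : Y → EReal) (c : X → Y) (μ : ℝ) (x : X) (y : Y) :
    EReal :=
  (f x : EReal) +
    ⨅ z, g z + ((inner ℝ y (c x - z) + 1 / (2 * μ) * ‖c x - z‖ ^ 2 : ℝ) : EReal)

/-- The sequences are generated by the classical augmented Lagrangian method with penalty
parameters `μ k`, tolerances `ε k`, and reduction factor bound `β`. -/
structure IsALMSequence (f : X → ℝ) (g : Y → EReal) (c : X → Y)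
    (β : ℝ) (μ ε : ℕ → ℝ) (x : ℕ → X) (z y : ℕ → Y) : Prop where
  beta_pos : 0 < β
  beta_lt_one : β < 1
  penalty_pos : 0 < μ 0
  tolerance_nonneg : ∀ k, 0 ≤ ε k
  /-- inexact global minimization of the augmented Lagrangian -/
  subproblem : ∀ k, augLagrangian f g c (μ k) (x k) (y k) ≤
    (⨅ x', augLagrangian f g c (μ k) x' (y k)) + (ε k : EReal)
  prox_step : ∀ k, IsProx (μ k) g (c (x k) + μ k • y k) (z k)
  multiplier_step : ∀ k, y (k + 1) = y k + (μ k)⁻¹ • (c (x k) - z k)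
  penalty_step : ∀ k, ∃ b : ℝ, ((0 < b ∧ b ≤ β) ∨ b = 1) ∧ μ (k + 1) = b * μ k

end Problem

end CompositeALM

open CompositeALM

set_option linter.unusedSectionVars false

namespace CompositeALM

/-! ### The value function: convexity, and subgradients at the origin as multipliers. -/

section Value

variable {X Y : Type*} [NormedAddCommGroup X] [InnerProductSpace ℝ X]
  [NormedAddCommGroup Y] [InnerProductSpace ℝ Y]

/-! The method is an inexact proximal point iteration on the dual of the convex value function `V`.
Minimizing the augmented Lagrangian over `x` and `z` amounts to minimizing `V u + ⟨y, u⟩ + ‖u‖² / (2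
μ)` over `u = c x - z`. Its exact minimizer `w k` satisfies `-q k ∈ ∂V (w k)` with `q k = y k + w k
/ μ k`, and strong convexity bounds `‖u k - w k‖²` by `2 μ k ε k`. Hence `y (k + 1) = q k + δ k`
with `‖δ k‖²` summable.

Descent of the dual function, bounded below because `V 0 = Φ*` is finite, gives `w k → 0`
(`tendsto_zero_of_inexact_prox`), so `c (x k) - z k → 0`. A cluster point of `y` would, by
closedness of `∂V` (`le_of_tendsto_subgradient`), be the negative of a subgradient of `V` at `0`,
hence a multiplier for a minimizer (`isStationaryPoint_of_subgradient`), which is excluded. Thus `‖y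
k‖ → ∞`.

Divergence forces `‖y k‖ ≤ ‖y (k + 1)‖` infinitely often. At such steps the augmentation term is
nonnegative, so `f (x k) + g (z k) ≤ Φ* + ε k`; this gives the liminf bound and, under boundedness,
the convergent subsequence. -/

lemma IsProper.exists_real {φ : Y → EReal} (h : IsProper φ) {z : Y} (hz : φ z < ⊤) :
    ∃ r : ℝ, φ z = r :=
  ⟨(φ z).toReal, (EReal.coe_toReal hz.ne (h.2 z)).symm⟩

lemma IsConvex.le_combo {φ : Y → EReal} (h : IsConvex φ) {u v : Y} {a b : ℝ}
    (hu : φ u ≤ a) (hv : φ v ≤ b) {t : ℝ} (h0 : 0 ≤ t) (h1 : t ≤ 1) :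
    φ (t • u + (1 - t) • v) ≤ ((t * a + (1 - t) * b : ℝ) : EReal) := by
  have := h (x := (u, a)) hu (y := (v, b)) hv h0 (sub_nonneg.2 h1) (by ring)
  simpa using this

lemma valueFunction_le (f : X → ℝ) (g : Y → EReal) (c : X → Y) (x : X) (u : Y) :
    valueFunction f g c u ≤ (f x : EReal) + g (c x - u) :=
  iInf_le _ x

lemma exists_lt_of_valueFunction_lt {f : X → ℝ} {g : Y → EReal} {c : X → Y} (hg : IsProper g)
    {u : Y} {a : ℝ} (h : valueFunction f g c u < a) :
    ∃ (x : X) (r : ℝ), g (c x - u) = r ∧ f x + r < a := by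
  obtain ⟨x, hx⟩ := iInf_lt_iff.1 h
  have hlt : g (c x - u) < ⊤ := by
    by_contra hc
    rw [not_lt_top_iff.1 hc, EReal.coe_add_top] at hx
    exact not_top_lt hx
  obtain ⟨r, hr⟩ := hg.exists_real hlt
  refine ⟨x, r, hr, ?_⟩
  rw [hr] at hx
  exact_mod_cast hx

/-- The value function of a fully convex composite problem is convex. -/
lemma FullyConvex.isConvex_valueFunction {f : X → ℝ} {g : Y → EReal} {c : X → Y}
    (hP : FullyConvex f g c) : IsConvex (valueFunction f g c) := by
  rintro ⟨u, a⟩ hu ⟨v, b⟩ hv s t hs ht hst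
  obtain rfl : t = 1 - s := by linarith
  simp only [mem_ofPred_eq, Prod.smul_mk, Prod.mk_add_mk, smul_eq_mul] at hu hv ⊢
  refine EReal.le_of_forall_lt_iff_le.1 fun r hr => ?_
  have hr' : s * a + (1 - s) * b < r := by exact_mod_cast hr
  -- The infima at `u` and `v` need not be attained; the slack `δ` pays for near-minimizers.
  obtain ⟨δ, hδ, hδr⟩ : ∃ δ > 0, s * a + (1 - s) * b + δ ≤ r :=
    ⟨r - (s * a + (1 - s) * b), by linarith, by linarith⟩
  obtain ⟨x, p, hp, hxp⟩ := exists_lt_of_valueFunction_lt hP.g_proper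
    (lt_of_le_of_lt hu (by exact_mod_cast (lt_add_of_pos_right a hδ)) :
      valueFunction f g c u < ((a + δ : ℝ) : EReal))
  obtain ⟨x', q, hq, hxq⟩ := exists_lt_of_valueFunction_lt hP.g_proper
    (lt_of_le_of_lt hv (by exact_mod_cast (lt_add_of_pos_right b hδ)) :
      valueFunction f g c v < ((b + δ : ℝ) : EReal))
  have hs1 : s ≤ 1 := by linarith
  have hcomb := hP.g_convex.le_combo hp.le hq.le hs hs1
  have hhor := hP.c_convex x x' s hs hs1 _ (hcomb.trans_lt (EReal.coe_lt_top _))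
  have hpt : s • (c x - u) + (1 - s) • (c x' - v) +
      (c (s • x + (1 - s) • x') - s • c x - (1 - s) • c x') =
      c (s • x + (1 - s) • x') - (s • u + (1 - s) • v) := by
    simp only [smul_sub]; abel
  rw [hpt] at hhor
  have hf := hP.f_convex.2 (mem_univ x) (mem_univ x') hs ht hst
  simp only [smul_eq_mul] at hf
  calc valueFunction f g c (s • u + (1 - s) • v)
      ≤ (f (s • x + (1 - s) • x') : EReal) + ((s * p + (1 - s) * q : ℝ) : EReal) :=
        (valueFunction_le f g c _ _).trans (add_le_add le_rfl (hhor.trans hcomb))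
    _ ≤ (r : EReal) := by
        rw [← EReal.coe_add, EReal.coe_le_coe_iff]
        nlinarith [mul_le_mul_of_nonneg_left hxp.le hs, mul_le_mul_of_nonneg_left hxq.le ht]

/-- A subgradient of the value function at the origin is, up to sign, a multiplier certifying
stationarity of every minimizer. -/
lemma isStationaryPoint_of_subgradient {f : X → ℝ} {g : Y → EReal} {c : X → Y}
    (hP : FullyConvex f g c) {x₀ : X} {G : ℝ} (hG : g (c x₀) = G) {q : Y}
    (hq : ∀ u, ((f x₀ + G - inner ℝ q u : ℝ) : EReal) ≤ valueFunction f g c u) :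
    IsStationaryPoint f g c x₀ := by
  -- Choosing `u = c x - z` decouples `x` and `z`: fixing `x = x₀` evaluates the conjugate at `q`,
  -- fixing `z = c x₀` makes `x₀` minimize `f + ⟨q, c⟩`.
  have hsub : ∀ x z, ∀ r : ℝ, g z = r → f x₀ + G - inner ℝ q (c x - z) ≤ f x + r := by
    intro x z r hr
    have h := (hq (c x - z)).trans (valueFunction_le f g c x _)
    rw [sub_sub_cancel, hr] at h
    exact_mod_cast h
  have hconj : ∀ y, ((inner ℝ (c x₀) y - G : ℝ) : EReal) ≤ conjugate g y := by
    intro y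
    refine le_trans ?_ (le_iSup _ (c x₀))
    rw [hG, EReal.coe_sub]
  have hval : conjugate g q = ((inner ℝ (c x₀) q - G : ℝ) : EReal) := by
    refine le_antisymm (iSup_le fun z => ?_) (hconj q)
    rcases eq_or_ne (g z) ⊤ with hz | hz
    · simp [hz]
    · obtain ⟨r, hr⟩ := hP.g_proper.exists_real (lt_top_iff_ne_top.2 hz)
      have h := hsub x₀ z r hr
      rw [hr, ← EReal.coe_sub, EReal.coe_le_coe_iff]
      rw [inner_sub_right, real_inner_comm, real_inner_comm z q] at h
      linarith
  refine ⟨hG ▸ EReal.coe_lt_top G, q, ?_, ?_⟩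
  · have hmin : IsLocalMin (fun x' : X => f x' + inner ℝ q (c x')) x₀ := by
      refine Filter.Eventually.of_forall fun x => ?_
      have h := hsub x (c x₀) G hG
      rw [inner_sub_right] at h
      simp only
      linarith
    have hd : DifferentiableAt ℝ (fun x' : X => f x' + inner ℝ q (c x')) x₀ := by
      have h1 := (hP.f_contDiff.differentiable one_ne_zero) x₀
      have h2 := (hP.c_contDiff.differentiable one_ne_zero) x₀
      exact h1.add ((differentiableAt_const q).inner ℝ h2)
    have := hd.hasFDerivAt
    rwa [hmin.fderiv_eq_zero] at this
  · refine ⟨by rw [hval]; exact EReal.coe_ne_bot _, by rw [hval]; exact EReal.coe_ne_top _,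
      fun y => ?_⟩
    rw [hval, ← EReal.coe_add]
    refine le_trans (le_of_eq ?_) (hconj y)
    rw [inner_sub_right]
    congr 1
    ring

end Value

/-! ### Existence and optimality of exact proximal points. -/

section Prox

variable {Y : Type*} [NormedAddCommGroup Y] [InnerProductSpace ℝ Y] [FiniteDimensional ℝ Y]

/-- A proper lower semicontinuous convex function that is finite at the origin decreases at most
linearly. -/
lemma exists_linear_lower_bound {φ : Y → EReal} (hp : IsProper φ) (hl : LowerSemicontinuous φ)
    (hc : IsConvex φ) {a : ℝ} (ha : φ 0 = a) :
    ∃ M : ℝ, 0 ≤ M ∧ ∀ u, ((-(M * (1 + ‖u‖)) : ℝ) : EReal) ≤ φ u := by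
  have : ProperSpace Y := FiniteDimensional.proper ℝ Y
  obtain ⟨w, -, hw⟩ := (hl.lowerSemicontinuousOn _).exists_isMinOn
    (s := Metric.closedBall (0 : Y) 1) ⟨0, by simp⟩ (isCompact_closedBall 0 1)
  have hw0 : φ w ≤ a := by rw [← ha]; exact hw (by simp)
  obtain ⟨m, hm⟩ := hp.exists_real (hw0.trans_lt (EReal.coe_lt_top a))
  refine ⟨|m| + |a|, by positivity, fun u => ?_⟩
  have hma : 0 ≤ |m| + |a| := by positivity
  rcases le_or_gt ‖u‖ 1 with hu | hu
  · have h : φ w ≤ φ u := hw (by simpa using hu)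
    rw [hm] at h
    refine le_trans (EReal.coe_le_coe_iff.2 ?_) h
    nlinarith [neg_abs_le m, abs_nonneg a, norm_nonneg u, abs_nonneg m]
  · refine EReal.le_of_forall_lt_iff_le.1 fun r hr => ?_
    have hu0 : 0 < ‖u‖ := by linarith
    -- The segment from `0` to `u` meets the unit sphere, where the ball minimum bounds `φ` from
    -- below.
    have hcomb := hc.le_combo hr.le ha.le (t := ‖u‖⁻¹) (by positivity)
      (inv_le_one_of_one_le₀ hu.le)
    have hball : φ w ≤ φ (‖u‖⁻¹ • u + (1 - ‖u‖⁻¹) • (0 : Y)) := by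
      refine hw ?_
      simp [norm_smul, hu0.ne']
    rw [hm] at hball
    have h := hball.trans hcomb
    rw [EReal.coe_le_coe_iff] at h ⊢
    have h2 := mul_le_mul_of_nonneg_left h hu0.le
    have e : ‖u‖ * (‖u‖⁻¹ * r + (1 - ‖u‖⁻¹) * a) = r + (‖u‖ - 1) * a := by field_simp
    rw [e] at h2
    nlinarith [neg_abs_le m, le_abs_self a, abs_nonneg a, abs_nonneg m]

/-- Existence of the proximal point, with its subgradient inequality. -/
lemma exists_prox_subgradient {φ : Y → EReal} (hp : IsProper φ) (hl : LowerSemicontinuous φ)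
    (hc : IsConvex φ) (h0 : φ 0 < ⊤) (y : Y) {γ : ℝ} (hγ : 0 < γ) :
    ∃ (w : Y) (r : ℝ), φ w = r ∧
      ∀ v, ((r - inner ℝ (y + γ⁻¹ • w) (v - w) : ℝ) : EReal) ≤ φ v := by
  have : ProperSpace Y := FiniteDimensional.proper ℝ Y
  obtain ⟨a, ha⟩ := hp.exists_real h0
  obtain ⟨M, hM0, hM⟩ := exists_linear_lower_bound hp hl hc ha
  set Q : Y → ℝ := fun u => inner ℝ y u + (2 * γ)⁻¹ * ‖u‖ ^ 2 with hQ
  have hQc : Continuous Q := by fun_prop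
  have hFl : LowerSemicontinuous fun u => φ u + (Q u : EReal) := by
    refine hl.add' (continuous_coe_real_ereal.comp hQc).lowerSemicontinuous fun u => ?_
    exact EReal.continuousAt_add (Or.inr (EReal.coe_ne_bot _)) (Or.inr (EReal.coe_ne_top _))
  -- Beyond radius `R` the quadratic term beats the linear lower bound, so values there exceed the
  -- value at `0`.
  obtain ⟨R, hR0, hR⟩ : ∃ R : ℝ, 0 < R ∧ ∀ s : ℝ, R < s →
      a < -(M * (1 + s)) - ‖y‖ * s + (2 * γ)⁻¹ * s ^ 2 := by
    refine ⟨2 * γ * (2 * M + ‖y‖ + |a|) + 1, by positivity, fun s hs => ?_⟩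
    have hpos : 0 ≤ 2 * γ * (2 * M + ‖y‖ + |a|) := by positivity
    have hs1 : 1 < s := by linarith
    have h1 : 2 * M + ‖y‖ + |a| < (2 * γ)⁻¹ * s := by
      rw [inv_mul_eq_div, lt_div_iff₀ (by positivity)]
      linarith
    have h2 := mul_lt_mul_of_pos_right h1 (by linarith : 0 < s)
    nlinarith [le_abs_self a, abs_nonneg a, mul_nonneg hM0 (by linarith : 0 ≤ s - 1),
      mul_nonneg (abs_nonneg a) (by linarith : 0 ≤ s - 1)]
  obtain ⟨w, -, hw⟩ := (hFl.lowerSemicontinuousOn _).exists_isMinOn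
    (s := Metric.closedBall (0 : Y) R) ⟨0, by simp [hR0.le]⟩ (isCompact_closedBall 0 R)
  have hw0 : φ w + (Q w : EReal) ≤ a := by
    have : φ w + (Q w : EReal) ≤ φ 0 + (Q 0 : EReal) := hw (by simp [hR0.le])
    simpa [hQ, ha] using this
  have hwmin : ∀ v, φ w + (Q w : EReal) ≤ φ v + (Q v : EReal) := by
    intro v
    rcases le_or_gt ‖v‖ R with hv | hv
    · exact hw (by simpa using hv)
    · refine hw0.trans (le_trans ?_ (add_le_add (hM v) le_rfl))
      rw [← EReal.coe_add, EReal.coe_le_coe_iff]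
      have h1 := hR _ hv
      have h2 := neg_le_of_abs_le (abs_real_inner_le_norm y v)
      simp only [hQ]
      linarith
  have hwt : φ w < ⊤ := by
    by_contra hcon
    rw [not_lt_top_iff.1 hcon, EReal.top_add_coe] at hw0
    exact absurd hw0 (not_le.2 (EReal.coe_lt_top a))
  obtain ⟨r, hr⟩ := hp.exists_real hwt
  refine ⟨w, r, hr, fun v => EReal.le_of_forall_lt_iff_le.1 fun s hs => ?_⟩
  rw [EReal.coe_le_coe_iff]
  -- Moving from `w` a fraction `t` towards `v` costs only `O(t²)` beyond first order; dividing by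
  -- `t` and letting `t → 0` removes it.
  have key : ∀ t : ℝ, 0 < t → t ≤ 1 →
      r - s ≤ inner ℝ (y + γ⁻¹ • w) (v - w) + t * ((2 * γ)⁻¹ * ‖v - w‖ ^ 2) := by
    intro t ht0 ht1
    have h1 := (hwmin (t • v + (1 - t) • w)).trans
      (add_le_add (hc.le_combo hs.le hr.le ht0.le ht1) le_rfl)
    rw [hr, ← EReal.coe_add, ← EReal.coe_add, EReal.coe_le_coe_iff] at h1
    have e : t • v + (1 - t) • w = w + t • (v - w) := by module
    have e2 : Q (t • v + (1 - t) • w) = Q w + t * inner ℝ (y + γ⁻¹ • w) (v - w) +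
        t ^ 2 * ((2 * γ)⁻¹ * ‖v - w‖ ^ 2) := by
      rw [e]
      simp only [hQ]
      rw [norm_add_sq_real, norm_smul, inner_smul_right, inner_add_right, inner_smul_right,
        inner_add_left, inner_smul_left, mul_pow, Real.norm_eq_abs, sq_abs]
      simp only [conj_trivial]
      field_simp
      ring
    rw [e2] at h1
    have h3 : t * (r - s) ≤
        t * (inner ℝ (y + γ⁻¹ • w) (v - w) + t * ((2 * γ)⁻¹ * ‖v - w‖ ^ 2)) := by
      nlinarith
    exact le_of_mul_le_mul_left h3 ht0
  have hlim : Tendsto (fun t : ℝ => inner ℝ (y + γ⁻¹ • w) (v - w) +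
      t * ((2 * γ)⁻¹ * ‖v - w‖ ^ 2)) (𝓝[>] 0) (𝓝 (inner ℝ (y + γ⁻¹ • w) (v - w))) := by
    have : Continuous fun t : ℝ => inner ℝ (y + γ⁻¹ • w) (v - w) +
      t * ((2 * γ)⁻¹ * ‖v - w‖ ^ 2) := by fun_prop
    have h := this.tendsto 0
    simp only [zero_mul, add_zero] at h
    exact h.mono_left nhdsWithin_le_nhds
  have := ge_of_tendsto hlim (b := r - s) (by
    filter_upwards [Ioc_mem_nhdsGT (zero_lt_one' ℝ)] with t ht using key t ht.1 ht.2)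
  linarith

end Prox

/-! ### Dual descent and closedness of the subdifferential. -/

section Descent

variable {Y : Type*} [NormedAddCommGroup Y] [InnerProductSpace ℝ Y]

/-- Descent of the dual function along an inexact proximal point iteration: the proximal points `w`
tend to `0`, provided the dual function is bounded below. -/
lemma tendsto_zero_of_inexact_prox {w q δ : ℕ → Y} {r μ : ℕ → ℝ} {Φ : ℝ}
    (hμ : ∀ k, 0 < μ k) (hμ0 : ∀ k, μ k ≤ μ 0)
    (hsub : ∀ k j, r k - inner ℝ (q k) (w j - w k) ≤ r j)
    (hbdd : ∀ k, r k + inner ℝ (q k) (w k) ≤ Φ)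
    (hstep : ∀ k, q (k + 1) = q k + δ k + (μ (k + 1))⁻¹ • w (k + 1))
    (hδ : Summable fun k => ‖δ k‖ ^ 2) : Tendsto w atTop (𝓝 0) := by
  -- For subgradients `-q k` at `w k`, this is the conjugate evaluated at `-q k`.
  set D : ℕ → ℝ := fun k => -inner ℝ (q k) (w k) - r k with hD
  have hμ00 := hμ 0
  have hdec : ∀ k, ‖w (k + 1)‖ ^ 2 ≤ 2 * μ 0 * (D k - D (k + 1)) + μ 0 ^ 2 * ‖δ k‖ ^ 2 := by
    intro k
    have h1 := hsub k (k + 1)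
    have h2 : inner ℝ (q (k + 1)) (w (k + 1)) = inner ℝ (q k) (w (k + 1)) +
        inner ℝ (δ k) (w (k + 1)) + (μ (k + 1))⁻¹ * ‖w (k + 1)‖ ^ 2 := by
      rw [hstep k, inner_add_left, inner_add_left, inner_smul_left, real_inner_self_eq_norm_sq]
      simp
    have h3 : inner ℝ (δ k) (w (k + 1)) + (μ (k + 1))⁻¹ * ‖w (k + 1)‖ ^ 2 ≤ D k - D (k + 1) := by
      rw [inner_sub_right] at h1
      simp only [hD]
      linarith
    have h4 : ‖w (k + 1)‖ ^ 2 ≤ μ 0 * ((μ (k + 1))⁻¹ * ‖w (k + 1)‖ ^ 2) := by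
      rw [← mul_assoc]
      refine le_mul_of_one_le_left (by positivity) ?_
      rw [← div_eq_mul_inv, one_le_div (hμ _)]
      exact hμ0 _
    have h5 := neg_le_of_abs_le (abs_real_inner_le_norm (δ k) (w (k + 1)))
    have h6 := mul_le_mul_of_nonneg_left h3 hμ00.le
    have h7 := mul_le_mul_of_nonneg_left h5 hμ00.le
    -- Young's inequality absorbs the cross term `μ 0 * ‖δ k‖ * ‖w (k + 1)‖`.
    nlinarith [sq_nonneg (μ 0 * ‖δ k‖ - ‖w (k + 1)‖)]
  have hsummable : Summable fun k => ‖w (k + 1)‖ ^ 2 := by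
    refine summable_of_sum_range_le
      (c := 2 * μ 0 * (D 0 + Φ) + μ 0 ^ 2 * ∑' k, ‖δ k‖ ^ 2) (fun _ => by positivity) fun n => ?_
    calc ∑ k ∈ Finset.range n, ‖w (k + 1)‖ ^ 2
        ≤ ∑ k ∈ Finset.range n, (2 * μ 0 * (D k - D (k + 1)) + μ 0 ^ 2 * ‖δ k‖ ^ 2) :=
          Finset.sum_le_sum fun k _ => hdec k
      _ = 2 * μ 0 * (D 0 - D n) + μ 0 ^ 2 * ∑ k ∈ Finset.range n, ‖δ k‖ ^ 2 := by
          rw [Finset.sum_add_distrib, ← Finset.mul_sum, ← Finset.mul_sum, Finset.sum_range_sub']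
      _ ≤ _ := by
          have h1 : -D n ≤ Φ := by
            have := hbdd n
            simp only [hD]
            linarith
          have h2 := hδ.sum_le_tsum (Finset.range n) fun _ _ => by positivity
          gcongr
          linarith
  have h1 := hsummable.tendsto_atTop_zero
  have h2 : Tendsto (fun k => ‖w (k + 1)‖) atTop (𝓝 0) := by
    simpa using h1.sqrt
  exact (tendsto_add_atTop_iff_nat 1).1 (tendsto_zero_iff_norm_tendsto_zero.2 h2)

/-- The graph of the subdifferential is closed at points where the function is finite. -/
lemma le_of_tendsto_subgradient {φ : Y → EReal} (hl : LowerSemicontinuous φ) {a : ℝ}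
    (ha : φ 0 = a) {w q : ℕ → Y} {r : ℕ → ℝ} {p : Y} (hr : ∀ k, φ (w k) = r k)
    (hsub : ∀ k v, ((r k - inner ℝ (q k) (v - w k) : ℝ) : EReal) ≤ φ v)
    (hw : Tendsto w atTop (𝓝 0)) (hq : Tendsto q atTop (𝓝 p)) (v : Y) :
    ((a - inner ℝ p v : ℝ) : EReal) ≤ φ v := by
  refine EReal.le_of_forall_lt_iff_le.1 fun s hs => ?_
  rw [EReal.coe_le_coe_iff]
  refine le_of_forall_lt_imp_le_of_dense fun b hb => ?_
  have hba : ((b + inner ℝ p v : ℝ) : EReal) < φ 0 := by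
    rw [ha, EReal.coe_lt_coe_iff]
    linarith
  have hev := hw.eventually (hl 0 _ hba)
  have hlim : Tendsto (fun k => s + inner ℝ (q k) (v - w k)) atTop (𝓝 (s + inner ℝ p (v - 0))) :=
    (hq.inner (tendsto_const_nhds.sub hw)).const_add s
  rw [sub_zero] at hlim
  have := ge_of_tendsto hlim (b := b + inner ℝ p v) (by
    filter_upwards [hev] with k hk
    have h1 := (hsub k v).trans hs.le
    rw [hr, gt_iff_lt, EReal.coe_lt_coe_iff] at hk
    rw [EReal.coe_le_coe_iff] at h1
    linarith)
  linarith

end Descent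

/-! ### One step of the method in terms of the value function. -/

section Algorithm

variable {X Y : Type*} [NormedAddCommGroup X] [InnerProductSpace ℝ X]
  [NormedAddCommGroup Y] [InnerProductSpace ℝ Y]

/-- The augmented Lagrangian term, up to a constant, is a proximal term. -/
lemma inner_add_norm_sq_eq {γ : ℝ} (hγ : 0 < γ) (y a z : Y) :
    inner ℝ y (a - z) + 1 / (2 * γ) * ‖a - z‖ ^ 2 =
      1 / (2 * γ) * ‖z - (a + γ • y)‖ ^ 2 - γ / 2 * ‖y‖ ^ 2 := by
  have e : z - (a + γ • y) = -((a - z) + γ • y) := by abel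
  rw [e, norm_neg, norm_add_sq_real, norm_smul, inner_smul_right, mul_pow, Real.norm_eq_abs,
    sq_abs, real_inner_comm]
  field_simp
  ring

lemma augLagrangian_le (f : X → ℝ) (g : Y → EReal) (c : X → Y) (γ : ℝ) (x : X) (y z : Y) {r : ℝ}
    (hr : g z = r) : augLagrangian f g c γ x y ≤
      ((f x + r + (inner ℝ y (c x - z) + 1 / (2 * γ) * ‖c x - z‖ ^ 2) : ℝ) : EReal) := by
  refine (add_le_add le_rfl (iInf_le _ z)).trans (le_of_eq ?_)
  rw [hr, ← EReal.coe_add, ← EReal.coe_add, add_assoc]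

lemma IsProx.lt_top {γ : ℝ} {g : Y → EReal} (hg : IsProper g) {v z : Y} (h : IsProx γ g v z) :
    g z < ⊤ := by
  obtain ⟨z₀, hz₀⟩ := hg.1
  obtain ⟨r, hr⟩ := hg.exists_real hz₀
  by_contra hcon
  have h1 : g z + ((1 / (2 * γ) * ‖z - v‖ ^ 2 : ℝ) : EReal) ≤
      g z₀ + ((1 / (2 * γ) * ‖z₀ - v‖ ^ 2 : ℝ) : EReal) := h (mem_univ z₀)
  rw [not_lt_top_iff.1 hcon, EReal.top_add_coe, hr, ← EReal.coe_add] at h1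
  exact absurd h1 (not_le.2 (EReal.coe_lt_top _))

/-- The infimum in the augmented Lagrangian is attained at the proximal point. -/
lemma IsProx.augLagrangian_ge {γ : ℝ} (hγ : 0 < γ) (f : X → ℝ) {g : Y → EReal} (c : X → Y)
    {x : X} {y z : Y} (h : IsProx γ g (c x + γ • y) z) {r : ℝ} (hr : g z = r) :
    ((f x + r + (inner ℝ y (c x - z) + 1 / (2 * γ) * ‖c x - z‖ ^ 2) : ℝ) : EReal) ≤
      augLagrangian f g c γ x y := by
  rw [add_assoc, EReal.coe_add]
  refine add_le_add le_rfl (le_iInf fun z' => ?_)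
  have h1 : g z + ((1 / (2 * γ) * ‖z - (c x + γ • y)‖ ^ 2 : ℝ) : EReal) ≤
      g z' + ((1 / (2 * γ) * ‖z' - (c x + γ • y)‖ ^ 2 : ℝ) : EReal) := h (mem_univ z')
  have h2 := add_le_add h1 (le_refl ((-(γ / 2 * ‖y‖ ^ 2) : ℝ) : EReal))
  rwa [add_assoc, add_assoc, ← EReal.coe_add, ← EReal.coe_add, ← sub_eq_add_neg,
    ← sub_eq_add_neg, ← inner_add_norm_sq_eq hγ, ← inner_add_norm_sq_eq hγ, hr] at h2

lemma IsALMSequence.penalty_pos_all {f : X → ℝ} {g : Y → EReal} {c : X → Y} {β : ℝ}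
    {μ ε : ℕ → ℝ} {x : ℕ → X} {z y : ℕ → Y} (h : IsALMSequence f g c β μ ε x z y) (k : ℕ) :
    0 < μ k := by
  induction k with
  | zero => exact h.penalty_pos
  | succ k ih =>
    obtain ⟨b, hb, hk⟩ := h.penalty_step k
    have hb0 : 0 < b := by
      rcases hb with hb | rfl
      exacts [hb.1, one_pos]
    rw [hk]
    exact mul_pos hb0 ih

lemma IsALMSequence.penalty_le {f : X → ℝ} {g : Y → EReal} {c : X → Y} {β : ℝ}
    {μ ε : ℕ → ℝ} {x : ℕ → X} {z y : ℕ → Y} (h : IsALMSequence f g c β μ ε x z y) (k : ℕ) :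
    μ k ≤ μ 0 := by
  refine antitone_nat_of_succ_le (fun k => ?_) k.zero_le
  obtain ⟨b, hb, hk⟩ := h.penalty_step k
  have hb1 : b ≤ 1 := by
    rcases hb with hb | rfl
    exacts [hb.2.trans h.beta_lt_one.le, le_rfl]
  rw [hk]
  exact mul_le_of_le_one_left (h.penalty_pos_all k).le hb1

/-- One step of the method, compared with an arbitrary point of the epigraph of the value
function. -/
lemma IsALMSequence.step_le {f : X → ℝ} {g : Y → EReal} {c : X → Y} (hg : IsProper g) {β : ℝ}
    {μ ε : ℕ → ℝ} {x : ℕ → X} {z y : ℕ → Y} (h : IsALMSequence f g c β μ ε x z y) (k : ℕ)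
    {γ : ℝ} (hγ : g (z k) = γ) {w : Y} {r : ℝ} (hr : valueFunction f g c w ≤ r) :
    f (x k) + γ + (inner ℝ (y k) (c (x k) - z k) + 1 / (2 * μ k) * ‖c (x k) - z k‖ ^ 2) ≤
      r + (inner ℝ (y k) w + 1 / (2 * μ k) * ‖w‖ ^ 2) + ε k := by
  refine le_of_forall_pos_le_add fun η hη => ?_
  obtain ⟨x', s, hs, hlt⟩ := exists_lt_of_valueFunction_lt hg
    (hr.trans_lt (EReal.coe_lt_coe_iff.2 (lt_add_of_pos_right r hη)))
  have h1 := ((h.prox_step k).augLagrangian_ge (h.penalty_pos_all k) f c hγ).trans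
    ((h.subproblem k).trans (add_le_add ((iInf_le _ x').trans
      (augLagrangian_le f g c (μ k) x' (y k) _ hs)) le_rfl))
  rw [← EReal.coe_add, EReal.coe_le_coe_iff, sub_sub_cancel] at h1
  linarith

end Algorithm

end CompositeALM

/-! ### Convergence of the method. -/

open CompositeALM
theorem theorem4p4 {X Y : Type*}
    [NormedAddCommGroup X] [InnerProductSpace ℝ X] [FiniteDimensional ℝ X]
    [NormedAddCommGroup Y] [InnerProductSpace ℝ Y] [FiniteDimensional ℝ Y]
    (f : X → ℝ) (g : Y → EReal) (c : X → Y)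
    (hP : FullyConvex f g c)
    (hirr : ∀ x, IsMinimizer f g c x → ¬ IsStationaryPoint f g c x)
    (hVproper : IsProper (valueFunction f g c))
    (hVlsc : LowerSemicontinuous (valueFunction f g c))
    (β : ℝ) (μ ε : ℕ → ℝ) (x : ℕ → X) (z y : ℕ → Y)
    (hALM : IsALMSequence f g c β μ ε x z y)
    (hsum : Summable (fun k => Real.sqrt (ε k / μ k))) :
    Tendsto (fun k => c (x k) - z k) atTop (𝓝 0) ∧
    Tendsto (fun k => ‖y k‖) atTop atTop ∧
    liminf (fun k => (f (x k) : EReal) + g (z k)) atTop ≤ optimalValue f g c ∧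
    (Bornology.IsBounded (range x) →
      ∃ (xbar : X) (σ : ℕ → ℕ), StrictMono σ ∧
        Tendsto (fun j => x (σ j)) atTop (𝓝 xbar) ∧
        IsMinimizer f g c xbar ∧
        Tendsto (fun j => z (σ j)) atTop (𝓝 (c xbar)) ∧
        Tendsto (fun j => (f (x (σ j)) : EReal) + g (z (σ j))) atTop
          (𝓝 (optimalValue f g c))) := by
  have hg := hP.g_proper
  have hμ := hALM.penalty_pos_all
  have hμ0 := hALM.penalty_le
  obtain ⟨x₀, hx₀, hx₀min⟩ := hP.exists_minimizer
  obtain ⟨G, hG⟩ := hg.exists_real hx₀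
  have hopt : optimalValue f g c = ((f x₀ + G : ℝ) : EReal) := by
    rw [EReal.coe_add, ← hG]
    exact le_antisymm (iInf_le _ x₀) (le_iInf fun x' => hx₀min (mem_univ x'))
  have hV0 : valueFunction f g c 0 = ((f x₀ + G : ℝ) : EReal) := by
    rw [← hopt]
    simp only [valueFunction, optimalValue, objective, sub_zero]
  set Φ := f x₀ + G
  have hnosub : ∀ q : Y, ¬ ∀ v, ((Φ - inner ℝ q v : ℝ) : EReal) ≤ valueFunction f g c v :=
    fun q hq => hirr x₀ ⟨hx₀, hx₀min⟩ (isStationaryPoint_of_subgradient hP hG hq)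
  choose γ hγ using fun k => hg.exists_real ((hALM.prox_step k).lt_top hg)
  -- exact proximal points
  choose w r hwr hsub using fun k => exists_prox_subgradient hVproper hVlsc
    hP.isConvex_valueFunction (hV0 ▸ EReal.coe_lt_top Φ) (y k) (hμ k)
  set u : ℕ → Y := fun k => c (x k) - z k with hu
  set q : ℕ → Y := fun k => y k + (μ k)⁻¹ • w k with hq
  have hVu : ∀ k, valueFunction f g c (u k) ≤ ((f (x k) + γ k : ℝ) : EReal) := by
    intro k
    have := valueFunction_le f g c (x k) (u k)
    rwa [hu, sub_sub_cancel, hγ, ← EReal.coe_add] at this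
  -- Add the `ε k`-optimality of `u k` against `w k` to the subgradient inequality at `w k` tested
  -- at `u k`; the quadratics complete to a square.
  have herr : ∀ k, ‖u k - w k‖ ^ 2 ≤ 2 * μ k * ε k := by
    intro k
    have h1 := hALM.step_le hg k (hγ k) (hwr k).le
    have h2 := (hsub k (u k)).trans (hVu k)
    rw [EReal.coe_le_coe_iff, inner_add_left, inner_smul_left, inner_sub_right (y k),
      inner_sub_right (w k), real_inner_self_eq_norm_sq, conj_trivial] at h2
    change f (x k) + γ k + (inner ℝ (y k) (u k) + 1 / (2 * μ k) * ‖u k‖ ^ 2) ≤ _ at h1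
    have h3 : (2 * μ k)⁻¹ * ‖u k - w k‖ ^ 2 ≤ ε k := by
      rw [norm_sub_sq_real, real_inner_comm]
      have e1 : 1 / (2 * μ k) = (μ k)⁻¹ / 2 := by field_simp
      have e2 : (2 * μ k)⁻¹ = (μ k)⁻¹ / 2 := by field_simp
      rw [e1] at h1
      rw [e2]
      nlinarith
    rwa [inv_mul_le_iff₀ (by have := hμ k; positivity)] at h3
  set δ : ℕ → Y := fun k => (μ k)⁻¹ • (u k - w k) with hδ
  have hεμ : ∀ k, 0 ≤ ε k / μ k := fun k => div_nonneg (hALM.tolerance_nonneg k) (hμ k).le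
  have hδle : ∀ k, ‖δ k‖ ^ 2 ≤ 2 * (ε k / μ k) := by
    intro k
    have h1 := mul_le_mul_of_nonneg_left (herr k) (sq_nonneg (μ k)⁻¹)
    have h2 := hμ k
    rw [hδ, norm_smul, mul_pow, Real.norm_eq_abs, sq_abs]
    refine h1.trans (le_of_eq ?_)
    field_simp
  have hsum2 : Summable fun k => ε k / μ k := by
    have h1 := hsum.tendsto_atTop_zero
    refine hsum.of_norm_bounded_eventually_nat ?_
    -- Once the square root is below one, it dominates its own square.
    filter_upwards [h1.eventually (gt_mem_nhds one_pos)] with k hk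
    rw [Real.norm_eq_abs, abs_of_nonneg (hεμ k)]
    nlinarith [Real.sq_sqrt (hεμ k), Real.sqrt_nonneg (ε k / μ k)]
  have hδsum : Summable fun k => ‖δ k‖ ^ 2 :=
    Summable.of_nonneg_of_le (fun _ => by positivity) hδle (hsum2.mul_left 2)
  have hδ0 : Tendsto δ atTop (𝓝 0) := by
    rw [tendsto_zero_iff_norm_tendsto_zero]
    simpa using hδsum.tendsto_atTop_zero.sqrt
  have hyq : ∀ k, y (k + 1) = q k + δ k := by
    intro k
    have h1 : y (k + 1) = y k + (μ k)⁻¹ • u k := hALM.multiplier_step k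
    simp only [h1, hq, hδ]
    module
  have hw0 : Tendsto w atTop (𝓝 0) := by
    refine tendsto_zero_of_inexact_prox (q := q) (δ := δ) (r := r) (Φ := Φ) hμ hμ0
      (fun k j => ?_) (fun k => ?_) (fun k => ?_) hδsum
    · have := hsub k (w j)
      rw [hwr j] at this
      exact_mod_cast this
    · have h1 := hsub k 0
      rw [hV0, EReal.coe_le_coe_iff, zero_sub, inner_neg_right] at h1
      linarith
    · rw [← hyq]
  have hu0 : Tendsto u atTop (𝓝 0) := by
    have h1 : Tendsto (fun k => u k - w k) atTop (𝓝 0) := by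
      have h2 : Tendsto (fun k => μ 0 * ‖δ k‖) atTop (𝓝 0) := by
        simpa using hδ0.norm.const_mul (μ 0)
      refine squeeze_zero_norm (fun k => ?_) h2
      have h3 : u k - w k = μ k • δ k := by rw [hδ, smul_inv_smul₀ (hμ k).ne']
      rw [h3, norm_smul, Real.norm_eq_abs, abs_of_pos (hμ k)]
      exact mul_le_mul_of_nonneg_right (hμ0 k) (norm_nonneg _)
    simpa using h1.add hw0
  have hε0 : Tendsto ε atTop (𝓝 0) := by
    have h1 : Tendsto (fun k => μ 0 * (ε k / μ k)) atTop (𝓝 0) := by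
      simpa using hsum2.tendsto_atTop_zero.const_mul (μ 0)
    refine squeeze_zero hALM.tolerance_nonneg (fun k => ?_) h1
    calc ε k = μ k * (ε k / μ k) := by rw [mul_div_cancel₀ _ (hμ k).ne']
      _ ≤ _ := mul_le_mul_of_nonneg_right (hμ0 k) (hεμ k)
  have hY : ProperSpace Y := FiniteDimensional.proper ℝ Y
  have hX : ProperSpace X := FiniteDimensional.proper ℝ X
  have hy : Tendsto (fun k => ‖y k‖) atTop atTop := by
    refine (tendsto_add_atTop_iff_nat 1).1 ?_
    by_contra hcon
    obtain ⟨R, hR⟩ : ∃ R : ℝ, ∃ᶠ k in atTop, ‖y (k + 1)‖ < R := by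
      rw [tendsto_atTop] at hcon
      push Not at hcon
      exact hcon
    obtain ⟨p, -, σ, hσ, hp⟩ := tendsto_subseq_of_frequently_bounded
      (Metric.isBounded_ball (x := (0 : Y)) (r := R)) (x := fun k => y (k + 1))
      (hR.mono fun k hk => by simpa using hk)
    have hqσ : Tendsto (fun j => q (σ j)) atTop (𝓝 p) := by
      have h1 := hp.sub (hδ0.comp hσ.tendsto_atTop)
      rw [sub_zero] at h1
      refine h1.congr fun j => ?_
      simp [hyq]
    exact hnosub p (le_of_tendsto_subgradient hVlsc hV0 (fun j => hwr (σ j))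
      (fun j => hsub (σ j)) (hw0.comp hσ.tendsto_atTop) hqσ)
  -- The augmentation term equals `μ k / 2 * (‖y (k + 1)‖² - ‖y k‖²)`; the step is compared with `w
  -- = 0`, where `V` equals `Φ`.
  have hval : ∀ k, ‖y k‖ ≤ ‖y (k + 1)‖ → f (x k) + γ k ≤ Φ + ε k := by
    intro k hk
    have h1 := hALM.step_le hg k (hγ k) hV0.le
    have h2 : ‖y (k + 1)‖ ^ 2 = ‖y k‖ ^ 2 + 2 * (μ k)⁻¹ *
        (inner ℝ (y k) (u k) + 1 / (2 * μ k) * ‖u k‖ ^ 2) := by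
      have h3 := hμ k
      have h4 : y (k + 1) = y k + (μ k)⁻¹ • u k := hALM.multiplier_step k
      rw [h4, norm_add_sq_real, norm_smul, inner_smul_right, mul_pow,
        Real.norm_eq_abs, sq_abs]
      field_simp
      ring
    have h4 : 0 ≤ inner ℝ (y k) (u k) + 1 / (2 * μ k) * ‖u k‖ ^ 2 := by
      have h5 : 0 < 2 * (μ k)⁻¹ := by have := hμ k; positivity
      have h6 : 0 ≤ 2 * (μ k)⁻¹ * (inner ℝ (y k) (u k) + 1 / (2 * μ k) * ‖u k‖ ^ 2) := by
        have := pow_le_pow_left₀ (norm_nonneg (y k)) hk 2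
        linarith
      exact nonneg_of_mul_nonneg_right h6 h5
    change f (x k) + γ k + (inner ℝ (y k) (u k) + 1 / (2 * μ k) * ‖u k‖ ^ 2) ≤ _ at h1
    simp only [inner_zero_right, norm_zero] at h1
    linarith
  have hfreq : ∃ᶠ k in atTop, ‖y k‖ ≤ ‖y (k + 1)‖ := by
    intro hcon
    obtain ⟨N, hN⟩ := eventually_atTop.1 hcon
    have hanti : ∀ k, N ≤ k → ‖y k‖ ≤ ‖y N‖ := by
      intro k hk
      induction k, hk using Nat.le_induction with
      | base => exact le_rfl
      | succ k hk ih => exact (not_le.1 (hN k hk)).le.trans ih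
    obtain ⟨k, hk1, hk2⟩ := ((hy.eventually_gt_atTop ‖y N‖).and (eventually_ge_atTop N)).exists
    exact absurd (hanti k hk2) (not_le.2 hk1)
  have hfγ : ∀ k, (f (x k) : EReal) + g (z k) = ((f (x k) + γ k : ℝ) : EReal) := by
    intro k
    rw [hγ, EReal.coe_add]
  refine ⟨hu0, hy, ?_, fun hbdd => ?_⟩
  · rw [hopt]
    refine EReal.le_of_forall_lt_iff_le.1 fun a ha => ?_
    rw [EReal.coe_lt_coe_iff] at ha
    refine liminf_le_of_frequently_le' ?_
    refine (hfreq.and_eventually (hε0.eventually (gt_mem_nhds (sub_pos.2 ha)))).mono fun k hk => ?_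
    rw [hfγ, EReal.coe_le_coe_iff]
    linarith [hval k hk.1, hk.2]
  -- Restrict to indices of nondecreasing multiplier norm before extracting a limit, so that `hval`
  -- holds along the whole subsequence.
  · obtain ⟨σ, hσ, hσy⟩ := extraction_of_frequently_atTop hfreq
    obtain ⟨xbar, -, τ, hτ, hx⟩ := tendsto_subseq_of_bounded hbdd
      (x := fun j => x (σ j)) (fun j => mem_range_self _)
    have hστ : Tendsto (fun j => σ (τ j)) atTop atTop := (hσ.comp hτ).tendsto_atTop
    replace hx : Tendsto (fun j => x (σ (τ j))) atTop (𝓝 xbar) := hx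
    have hz : Tendsto (fun j => z (σ (τ j))) atTop (𝓝 (c xbar)) := by
      have h1 := ((hP.c_contDiff.continuous.tendsto xbar).comp hx).sub (hu0.comp hστ)
      rw [sub_zero] at h1
      refine h1.congr fun j => ?_
      simp [hu]
    have hfx : Tendsto (fun j => f (x (σ (τ j)))) atTop (𝓝 (f xbar)) :=
      (hP.f_contDiff.continuous.tendsto xbar).comp hx
    have hup : Tendsto (fun j => Φ + ε (σ (τ j))) atTop (𝓝 Φ) := by
      simpa using (hε0.comp hστ).const_add Φ
    have hle : g (c xbar) ≤ ((Φ - f xbar : ℝ) : EReal) := by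
      refine EReal.ge_of_forall_gt_iff_ge.1 fun b hb => ?_
      rw [EReal.coe_le_coe_iff]
      have hlow : Tendsto (fun j => f (x (σ (τ j))) + b) atTop (𝓝 (f xbar + b)) :=
        hfx.add_const b
      have := le_of_tendsto_of_tendsto hlow hup (by
        filter_upwards [hz.eventually (hP.g_lsc (c xbar) b hb)] with j hj
        rw [hγ, gt_iff_lt, EReal.coe_lt_coe_iff] at hj
        linarith [hval _ (hσy (τ j))])
      linarith
    have hfeas : g (c xbar) < ⊤ := hle.trans_lt (EReal.coe_lt_top _)
    obtain ⟨Gb, hGb⟩ := hg.exists_real hfeas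
    have hmin : IsMinOn (objective f g c) univ xbar := by
      intro x' _
      have h1 : objective f g c xbar ≤ optimalValue f g c := by
        rw [hopt, objective]
        refine (add_le_add le_rfl hle).trans (le_of_eq ?_)
        rw [← EReal.coe_add, add_sub_cancel]
      exact h1.trans (iInf_le _ x')
    have hΦb : Φ ≤ f xbar + Gb := by
      have h1 : optimalValue f g c ≤ objective f g c xbar := iInf_le _ xbar
      rw [hopt, objective, hGb, ← EReal.coe_add, EReal.coe_le_coe_iff] at h1
      exact h1
    refine ⟨xbar, σ ∘ τ, hσ.comp hτ, hx, ⟨hfeas, hmin⟩, hz, ?_⟩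
    simp only [Function.comp_apply, hfγ, hopt]
    refine (continuous_coe_real_ereal.tendsto Φ).comp
      (tendsto_order.2 ⟨fun a ha => ?_, fun a ha => ?_⟩)
    -- One `η` is spent on lower semicontinuity of `g`, the other on continuity of `f`.
    · obtain ⟨η, hη, hηa⟩ : ∃ η > 0, a + 2 * η ≤ Φ := ⟨(Φ - a) / 2, by linarith, by linarith⟩
      have hb : ((Gb - η : ℝ) : EReal) < g (c xbar) := by
        rw [hGb, EReal.coe_lt_coe_iff]
        linarith
      filter_upwards [hz.eventually (hP.g_lsc (c xbar) _ hb),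
        hfx.eventually (lt_mem_nhds (sub_lt_self _ hη))] with j hj1 hj2
      rw [hγ, gt_iff_lt, EReal.coe_lt_coe_iff] at hj1
      linarith
    · filter_upwards [hup.eventually (gt_mem_nhds ha)] with j hj
      exact (hval _ (hσy (τ j))).trans_lt hj
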